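/- Let $D$ be a finite digraph without loops or parallel edges, with a root $r \in V(D)$ of in-degree $0$. We say that $D$ is connected if every vertex of $D$ is reachable from $r$. A cut-vertex is a vertex $v \neq r$ such that $D - v$ is not connected (some vertex of $D-v$ is not reachable from $r$ in $D-v$); ${\rm cv}(D)$ denotes the set of cut-vertices of $D$. A cut-edge is an edge $(u,v)$ such that $D - (u,v)$ is not connected; it is branching if there is another cut-edge with the same tail $u$. A vertex $v$ is special if it has in-degree at least $3$ or there is an edge $(u,v)\in E(D)$ with $(v,u)\notin E(D)$; ${\rm sp}(D)$ denotes the set of special vertices of $D$. An outbranching of $D$ rooted at $r$ is a spanning tree of $D$ with all edges oriented away from $r$; its leaves are the vertices of out-degree $0$ in it, and ${\rm maxleaf}(D)$ is the maximum number of leaves of an outbranching of $D$ rooted at $r$. **Theorem.** Let $D$ be a connected rooted digraph such that every cut-edge of $D$ is branching. Then $${\rm maxleaf}(D) \ \geq\ \frac{|{\rm sp}(D)|}{30} - |{\rm cv}(D)| \qquad\text{and}\qquad {\rm maxleaf}(D) \ \geq\ \frac{|{\rm sp}(D)|}{60}.$$ -/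

import Mathlib

namespace RootedDigraph

/-- `(D, r)` is a rooted digraph: `D` has no loops and the root `r` has in-degree `0`.
(Parallel edges are impossible, since the edges of a `Digraph` form a binary relation.) -/
structure IsRooted {V : Type*} (D : Digraph V) (r : V) : Prop where
  loopless : ∀ v, ¬ D.Adj v v
  no_edge_into_root : ∀ u, ¬ D.Adj u r

/-- There is a directed walk (possibly of length `0`) from `u` to `v` in `D`. -/
def Reachable {V : Type*} (D : Digraph V) (u v : V) : Prop :=
  Relation.ReflTransGen D.Adj u v

/-- Connected, in the rooted sense: every vertex is reachable from the root. -/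
def IsConnected {V : Type*} (D : Digraph V) (r : V) : Prop :=
  ∀ v, Reachable D r v

/-- `D - (u, v)`: the single edge `(u, v)` is removed. -/
def deleteEdge {V : Type*} (D : Digraph V) (u v : V) : Digraph V where
  Adj a b := D.Adj a b ∧ ¬ (a = u ∧ b = v)

/-- `D - v`: the vertex `v` is removed together with all its incident edges. -/
def deleteVertex {V : Type*} (D : Digraph V) (v : V) : Digraph {w : V // w ≠ v} where
  Adj a b := D.Adj a b

/-- A cut-edge is an edge `(u, v)` such that `D - (u, v)` is not connected. -/
def IsCutEdge {V : Type*} (D : Digraph V) (r u v : V) : Prop :=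
  D.Adj u v ∧ ¬ IsConnected (deleteEdge D u v) r

/-- A cut-vertex is a vertex `v ≠ r` such that `D - v` is not connected. -/
def IsCutVertex {V : Type*} (D : Digraph V) (r v : V) : Prop :=
  ∃ h : r ≠ v, ¬ IsConnected (deleteVertex D v) ⟨r, h⟩

/-- The set of cut-vertices. -/
def cv {V : Type*} (D : Digraph V) (r : V) : Set V :=
  {v | IsCutVertex D r v}

/-- A cut-edge `(u, v)` is branching if there is another cut-edge with the same tail `u`. -/
def IsBranching {V : Type*} (D : Digraph V) (r u v : V) : Prop :=
  IsCutEdge D r u v ∧ ∃ w, w ≠ v ∧ IsCutEdge D r u w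

/-- A vertex is special if it has in-degree at least `3` or it is the head of a simple edge,
i.e. of an edge `(u, v)` such that `(v, u)` is not an edge. -/
def IsSpecial {V : Type*} (D : Digraph V) (v : V) : Prop :=
  3 ≤ {u | D.Adj u v}.ncard ∨ ∃ u, D.Adj u v ∧ ¬ D.Adj v u

/-- The set of special vertices. -/
def sp {V : Type*} (D : Digraph V) : Set V :=
  {v | IsSpecial D v}

/-- `T` is an outbranching of `D` rooted at `r`: a spanning subgraph of `D` that is a tree with
all edges oriented away from `r`. Equivalently: the root has no parent in `T`, every vertex has at
most one parent in `T`, and every vertex is reachable from `r` in `T`. -/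
structure IsOutbranching {V : Type*} (D : Digraph V) (r : V) (T : Digraph V) : Prop where
  le : T ≤ D
  root_no_parent : ∀ u, ¬ T.Adj u r
  parent_unique : ∀ u u' v, T.Adj u v → T.Adj u' v → u = u'
  reachable : ∀ v, Reachable T r v

/-- The leaves of `T`: the vertices of out-degree `0`. -/
def leaves {V : Type*} (T : Digraph V) : Set V :=
  {v | ∀ w, ¬ T.Adj v w}

/-- The maximum number of leaves of an outbranching of `D` rooted at `r`. -/
noncomputable def maxleaf {V : Type*} (D : Digraph V) (r : V) : ℕ :=
  sSup {k | ∃ T, IsOutbranching D r T ∧ (leaves T).ncard = k}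

end RootedDigraph

/-! Suppose first that there are no cut-vertices. Then the vertices can be numbered so that every
non-root vertex is an out-neighbour of the root or has in-neighbours both below and above it
(`IsBiconnected.exists_numbering`). Upward edges and downward edges, each together with the edges
leaving the root, then form two acyclic spanning subdigraphs. In an acyclic subdigraph parents can
be chosen independently, and a transversal argument bounds the vertices with two possible parents,
and the out-neighbours of the root, by `3 * maxleaf` (`ncard_le_three_mul_maxleaf`). Used in both
directions, this bounds the vertices of in-degree at least 3. Used for two lexicographic orders of a
tree, it bounds the heads of edges between incomparable vertices (`ncard_transverseHeads_le`); a
simple edge forces such an edge in an upward or a downward tree. The total is 6 + 12 + 12 = 30. In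
general, duplicating each cut-vertex leaves no cut-vertices, loses no special vertices and raises
`maxleaf` by at most the number of cut-vertices. When cut-edges branch, each cut-vertex has two
children in a breadth-first tree, so that number is itself at most `maxleaf`, which gives the
constant 60. -/

namespace RootedDigraph

/-! ### Outbranchings from parent maps -/

/-- A well-founded choice of parents is an outbranching whose leaves are the vertices that are
nobody's parent. -/
theorem isOutbranching_of_parent {V : Type*} {D : Digraph V} {r : V} {E : V → V → Prop}
    (hwf : WellFounded E) (hED : ∀ u v, E u v → D.Adj u v) (p : V → V)
    (hp : ∀ v, v ≠ r → E (p v) v) :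
    IsOutbranching D r ⟨fun u v => v ≠ r ∧ u = p v⟩ where
  le := by
    rintro u v ⟨hv, rfl⟩
    exact hED _ _ (hp v hv)
  root_no_parent := fun u h => h.1 rfl
  parent_unique := by
    rintro u u' v ⟨_, rfl⟩ ⟨_, rfl⟩
    rfl
  reachable := by
    intro v
    induction v using hwf.induction with
    | _ v ih =>
      by_cases hv : v = r
      · subst hv; exact Relation.ReflTransGen.refl
      · exact (ih _ (hp v hv)).tail ⟨hv, rfl⟩

theorem bddAbove_leafCounts {V : Type*} [Finite V] (D : Digraph V) (r : V) :
    BddAbove {k | ∃ T, IsOutbranching D r T ∧ (leaves T).ncard = k} := by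
  refine ⟨Nat.card V, ?_⟩
  rintro k ⟨T, _, rfl⟩
  exact Set.ncard_le_card _

theorem ncard_leaves_le_maxleaf {V : Type*} [Finite V] {D : Digraph V} {r : V} {T : Digraph V}
    (hT : IsOutbranching D r T) : (leaves T).ncard ≤ maxleaf D r :=
  le_csSup (bddAbove_leafCounts D r) ⟨T, hT, rfl⟩

theorem ncard_le_maxleaf_of_parent {V : Type*} [Finite V] {D : Digraph V} {r : V}
    {E : V → V → Prop} (hwf : WellFounded E) (hED : ∀ u v, E u v → D.Adj u v) (p : V → V)
    (hp : ∀ v, v ≠ r → E (p v) v) {S : Set V} (hS : ∀ v, v ≠ r → p v ∉ S) :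
    S.ncard ≤ maxleaf D r := by
  refine le_trans (Set.ncard_le_ncard ?_ (Set.toFinite _))
    (ncard_leaves_le_maxleaf (isOutbranching_of_parent hwf hED p hp))
  rintro v hv w ⟨hw, rfl⟩
  exact hS w hw hv

/-! ### Leaves in acyclic subdigraphs -/

/-- A multigraph with `n` vertices and `m` edges has a vertex cover of size at most
`(m + n) / 3`. -/
theorem exists_small_transversal {α β : Type*} [DecidableEq α] [DecidableEq β] (A : Finset α)
    (B : Finset β) (x y : α → β) (hx : ∀ a ∈ A, x a ∈ B) (hy : ∀ a ∈ A, y a ∈ B)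
    (hne : ∀ a ∈ A, x a ≠ y a) :
    ∃ X ⊆ B, (∀ a ∈ A, x a ∈ X ∨ y a ∈ X) ∧ 3 * X.card ≤ A.card + B.card := by
  induction hn : B.card generalizing A B with
  | zero =>
    refine ⟨∅, Finset.empty_subset _, fun a ha => ?_, by simp⟩
    have := hx a ha
    rw [Finset.card_eq_zero] at hn
    simp [hn] at this
  | succ n ih =>
    -- A vertex of degree at least 2 joins the cover: it removes two edges and one vertex, lowering
    -- `m + n` by 3. If there is none, the edges form a matching, so `2 * m ≤ n` and one end of each
    -- edge suffices.
    by_cases h : ∃ b ∈ B, 2 ≤ (A.filter fun a => x a = b ∨ y a = b).card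
    · obtain ⟨b, hb, h2⟩ := h
      obtain ⟨X, hXB, hX, hc⟩ := ih (A.filter fun a => ¬ (x a = b ∨ y a = b)) (B.erase b)
        (fun a ha => by
          simp only [Finset.mem_filter, not_or] at ha
          exact Finset.mem_erase.2 ⟨ha.2.1, hx a ha.1⟩)
        (fun a ha => by
          simp only [Finset.mem_filter, not_or] at ha
          exact Finset.mem_erase.2 ⟨ha.2.2, hy a ha.1⟩)
        (fun a ha => hne a (Finset.mem_filter.1 ha).1)
        (by rw [Finset.card_erase_of_mem hb, hn]; rfl)
      refine ⟨insert b X, Finset.insert_subset hb (hXB.trans (Finset.erase_subset _ _)), ?_, ?_⟩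
      · intro a ha
        by_cases hab : x a = b ∨ y a = b
        · rcases hab with h | h <;> simp [h]
        · rcases hX a (Finset.mem_filter.2 ⟨ha, hab⟩) with h | h <;> simp [h]
      · have h1 := Finset.card_insert_le b X
        have h3 := Finset.card_filter_add_card_filter_not (s := A) (fun a => x a = b ∨ y a = b)
        omega
    · push Not at h
      have key : ∀ a ∈ A, ∀ a' ∈ A, ∀ b ∈ B, (x a = b ∨ y a = b) → (x a' = b ∨ y a' = b) →
          a = a' := by
        intro a ha a' ha' b hb h1 h2
        exact Finset.card_le_one.1 (Nat.lt_succ_iff.1 (h b hb)) a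
          (Finset.mem_filter.2 ⟨ha, h1⟩) a' (Finset.mem_filter.2 ⟨ha', h2⟩)
      refine ⟨A.image x, ?_, fun a ha => Or.inl (Finset.mem_image_of_mem _ ha), ?_⟩
      · intro b hb
        obtain ⟨a, ha, rfl⟩ := Finset.mem_image.1 hb
        exact hx a ha
      have cx : (A.image x).card = A.card := Finset.card_image_of_injOn fun a ha a' ha' e =>
        key a ha a' ha' (x a) (hx a ha) (Or.inl rfl) (Or.inl e.symm)
      have cy : (A.image y).card = A.card := Finset.card_image_of_injOn fun a ha a' ha' e =>
        key a ha a' ha' (y a) (hy a ha) (Or.inr rfl) (Or.inr e.symm)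
      have hd : Disjoint (A.image x) (A.image y) := by
        rw [Finset.disjoint_left]
        intro b hb hb'
        obtain ⟨a, ha, rfl⟩ := Finset.mem_image.1 hb
        obtain ⟨a', ha', e⟩ := Finset.mem_image.1 hb'
        have := key a ha a' ha' (x a) (hx a ha) (Or.inl rfl) (Or.inr e)
        subst this
        exact hne a ha e.symm
      have hu : (A.image x ∪ A.image y).card ≤ B.card := Finset.card_le_card <| by
        intro b hb
        rcases Finset.mem_union.1 hb with hb | hb
        · obtain ⟨a, ha, rfl⟩ := Finset.mem_image.1 hb
          exact hx a ha
        · obtain ⟨a, ha, rfl⟩ := Finset.mem_image.1 hb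
          exact hy a ha
      rw [Finset.card_union_of_disjoint hd] at hu
      omega

/-- In an acyclic spanning subdigraph in which every non-root vertex has an in-neighbour, the
out-neighbours of the root and the vertices of in-degree at least two force many leaves. -/
theorem ncard_le_three_mul_maxleaf {V : Type*} [Finite V] {D : Digraph V} {r : V}
    {E : V → V → Prop} (hwf : WellFounded E) (hED : ∀ u v, E u v → D.Adj u v)
    (hE : ∀ v, v ≠ r → ∃ u, E u v) :
    {v | v ≠ r ∧ (E r v ∨ ∃ u u', u ≠ u' ∧ E u v ∧ E u' v)}.ncard ≤ 3 * maxleaf D r := by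
  classical
  have := Fintype.ofFinite V
  set X : Finset V :=
    Finset.univ.filter fun v => v ≠ r ∧ (E r v ∨ ∃ u u', u ≠ u' ∧ E u v ∧ E u' v) with hX
  have hXc : {v | v ≠ r ∧ (E r v ∨ ∃ u u', u ≠ u' ∧ E u v ∧ E u' v)}.ncard = X.card := by
    rw [← Set.ncard_coe_finset]
    congr 1
    ext v
    simp [hX]
  rw [hXc]
  have : ∀ v, ∃ u, v ≠ r → E u v := fun v => by
    by_cases h : v = r
    · exact ⟨v, fun h' => absurd h h'⟩
    · exact (hE v h).imp fun u hu _ => hu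
  choose q hq using this
  -- `F` holds the forced internal vertices: the root and one parent for each non-root vertex
  -- outside `X`, so `|F| ≤ n - |X|`. Vertices of `A` have at least two in-neighbours, all outside
  -- `F`, and a transversal `Y` provides their parents. The leaves number at least `n - |F| - |Y| ≥
  -- (2 * (n - |F|) - |X|) / 3 ≥ |X| / 3`.
  set F : Finset V := insert r ((Finset.univ \ insert r X).image q) with hF
  set A : Finset V := X.filter fun v => ¬ ∃ u ∈ F, E u v with hA
  have : ∀ v, ∃ u u', v ∈ A → u ≠ u' ∧ E u v ∧ E u' v := fun v => by
    by_cases h : v ∈ A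
    · have h' := h
      simp only [hA, hX, Finset.mem_filter, Finset.mem_univ, true_and] at h
      rcases h.1.2 with h1 | ⟨u, u', h1⟩
      · exact absurd ⟨r, by simp [hF], h1⟩ h.2
      · exact ⟨u, u', fun _ => h1⟩
    · exact ⟨v, v, fun h' => absurd h' h⟩
  choose x y hxy using this
  have hB : ∀ v ∈ A, ∀ u, E u v → u ∈ Finset.univ \ F := fun v hv u hu => by
    rw [Finset.mem_sdiff]
    exact ⟨Finset.mem_univ _, fun huF => (Finset.mem_filter.1 hv).2 ⟨u, huF, hu⟩⟩
  obtain ⟨Y, hYB, hY, hYc⟩ := exists_small_transversal A (Finset.univ \ F) x y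
    (fun a ha => hB a ha _ (hxy a ha).2.1) (fun a ha => hB a ha _ (hxy a ha).2.2)
    (fun a ha => (hxy a ha).1)
  have : ∀ v, ∃ u, v ≠ r → E u v ∧ u ∈ F ∪ Y := fun v => by
    by_cases hv : v = r
    · exact ⟨v, fun h' => absurd hv h'⟩
    by_cases hvX : v ∈ X
    · by_cases hvA : v ∈ A
      · rcases hY v hvA with h | h
        · exact ⟨x v, fun _ => ⟨(hxy v hvA).2.1, Finset.mem_union_right _ h⟩⟩
        · exact ⟨y v, fun _ => ⟨(hxy v hvA).2.2, Finset.mem_union_right _ h⟩⟩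
      · have : ∃ u ∈ F, E u v := by
          by_contra h
          exact hvA (Finset.mem_filter.2 ⟨hvX, h⟩)
        obtain ⟨u, hu, huv⟩ := this
        exact ⟨u, fun _ => ⟨huv, Finset.mem_union_left _ hu⟩⟩
    · refine ⟨q v, fun _ => ⟨hq v hv, Finset.mem_union_left _ ?_⟩⟩
      exact Finset.mem_insert_of_mem (Finset.mem_image_of_mem _ (by simp [hv, hvX]))
  choose p hp using this
  have hleaf := ncard_le_maxleaf_of_parent (D := D) (r := r) hwf hED p (fun v hv => (hp v hv).1)
    (S := ((Finset.univ \ (F ∪ Y) : Finset V) : Set V)) (fun v hv h => by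
      simp only [Finset.coe_sdiff, Set.mem_sdiff, Finset.mem_coe] at h
      exact h.2 (hp v hv).2)
  rw [Set.ncard_coe_finset] at hleaf
  have hrX : r ∉ X := by simp [hX]
  have c1 : (Finset.univ \ (F ∪ Y)).card + (F ∪ Y).card = (Finset.univ : Finset V).card :=
    Finset.card_sdiff_add_card_eq_card (Finset.subset_univ _)
  have c2 := Finset.card_union_le F Y
  have c3 : (Finset.univ \ F).card + F.card = (Finset.univ : Finset V).card :=
    Finset.card_sdiff_add_card_eq_card (Finset.subset_univ _)
  have c4 : (Finset.univ \ insert r X).card + (insert r X).card = (Finset.univ : Finset V).card :=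
    Finset.card_sdiff_add_card_eq_card (Finset.subset_univ _)
  have c5 : (insert r X).card = X.card + 1 := Finset.card_insert_of_notMem hrX
  have c6 : F.card ≤ (Finset.univ \ insert r X).card + 1 :=
    (Finset.card_insert_le _ _).trans (Nat.add_le_add_right Finset.card_image_le _)
  have c7 : A.card ≤ X.card := Finset.card_filter_le _ _
  omega

/-! ### Edges transverse to a tree -/

/-- Two lists of which neither is a prefix of the other are compared in opposite ways by the two
lexicographic orders that come from an order on the letters and its opposite. -/
theorem isPrefix_or_map_neg_lt {l₁ l₂ : List ℤ} (h : l₁ < l₂) :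
    l₁ <+: l₂ ∨ l₂.map Neg.neg < l₁.map Neg.neg := by
  induction h with
  | nil => exact Or.inl List.nil_prefix
  | rel h => exact Or.inr (List.Lex.rel (neg_lt_neg h))
  | cons _ ih =>
    rcases ih with ih | ih
    · exact Or.inl (List.prefix_cons_inj _ |>.2 ih)
    · exact Or.inr (List.Lex.cons ih)

theorem list_lt_append_singleton (l : List ℤ) (a : ℤ) : l < l ++ [a] := by
  induction l with
  | nil => exact List.Lex.nil
  | cons b l ih => exact List.Lex.cons ih

/-- The relation "`u` is the parent of `v`" of the tree given by the parent map `p`. -/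
def ParentRel {V : Type*} (r : V) (p : V → V) (u v : V) : Prop := v ≠ r ∧ u = p v

/-- The relation "`u` is an ancestor of `v`, or equal to `v`". -/
def Ancestor {V : Type*} (r : V) (p : V → V) : V → V → Prop :=
  Relation.ReflTransGen (ParentRel r p)

/-- Listing labels on the way from the root lets prefixes detect ancestors. The labels are integers
so that negation reverses the order of siblings. -/
theorem exists_rootPath {V : Type*} [Finite V] {r : V} {p : V → V}
    (hwf : WellFounded (ParentRel r p)) :
    ∃ path : V → List ℤ, (∀ v, v ≠ r → ∃ a, path v = path (p v) ++ [a]) ∧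
      ∀ u v, path u <+: path v → Ancestor r p u v := by
  classical
  obtain ⟨n, ⟨e⟩⟩ := Finite.exists_equiv_fin V
  let path : V → List ℤ := hwf.fix fun v ih =>
    if h : v = r then [] else ih (p v) ⟨h, rfl⟩ ++ [((e v : ℕ) : ℤ)]
  have hr : path r = [] := by
    simp only [path]
    rw [hwf.fix_eq]
    simp
  have hs : ∀ v, v ≠ r → path v = path (p v) ++ [((e v : ℕ) : ℤ)] := fun v hv => by
    simp only [path]
    rw [hwf.fix_eq]
    simp [hv]
  refine ⟨path, fun v hv => ⟨_, hs v hv⟩, fun u v => ?_⟩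
  induction v using hwf.induction with
  | _ v ih =>
    intro h
    by_cases hv : v = r
    · subst hv
      by_cases hu : u = v
      · subst hu; exact Relation.ReflTransGen.refl
      · rw [hr, hs u hu] at h
        simp at h
    · rw [hs v hv, List.prefix_concat_iff] at h
      rcases h with h | h
      · by_cases hu : u = r
        · rw [hu, hr] at h
          simp at h
        · rw [hs u hu] at h
          have h2 := (List.append_inj' h rfl).2
          have : u = v := by
            apply e.injective
            apply Fin.ext
            simpa using h2
          subst this; exact Relation.ReflTransGen.refl
      · exact (ih _ ⟨hv, rfl⟩ h).tail ⟨hv, rfl⟩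

theorem ancestor_root {V : Type*} {r : V} {p : V → V}
    (hwf : WellFounded (ParentRel r p)) (v : V) : Ancestor r p r v := by
  induction v using hwf.induction with
  | _ v ih =>
    by_cases hv : v = r
    · subst hv; exact Relation.ReflTransGen.refl
    · exact (ih _ ⟨hv, rfl⟩).tail ⟨hv, rfl⟩

theorem wellFounded_of_rank {V α : Type*} [Finite V] [Preorder α] {E : V → V → Prop}
    (rank : V → α) (h : ∀ u v, E u v → rank u < rank v) : WellFounded E := by
  have : IsTrans V (InvImage (· < ·) rank) := ⟨fun _ _ _ h h' => lt_trans (α := α) h h'⟩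
  have : Std.Irrefl (InvImage (· < ·) rank) := ⟨fun _ h => lt_irrefl (α := α) _ h⟩
  exact Subrelation.wf (fun {u v} huv => h u v huv)
    (Finite.wellFounded_of_trans_of_irrefl (InvImage (· < ·) rank))

/-- The heads of the edges of `D` whose ends are incomparable in the tree given by `p`. -/
def transverseHeads {V : Type*} (D : Digraph V) (r : V) (p : V → V) : Set V :=
  {v | ∃ u, D.Adj u v ∧ ¬ Ancestor r p u v ∧ ¬ Ancestor r p v u}

/-- The two lexicographic orders, with siblings ordered one way or the other, both place parents
first, and a transverse edge goes up in one of them. There its head has two in-neighbours, the tail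
and the tree parent, so each order contributes at most `3 * maxleaf` heads. -/
theorem ncard_transverseHeads_le {V : Type*} [Finite V] {D : Digraph V} {r : V} {p : V → V}
    (hwf : WellFounded (ParentRel r p)) (hp : ∀ v, v ≠ r → D.Adj (p v) v) :
    (transverseHeads D r p).ncard ≤ 6 * maxleaf D r := by
  obtain ⟨path, hpath, hanc⟩ := exists_rootPath hwf
  have hlt : ∀ v, v ≠ r → path (p v) < path v := fun v hv => by
    obtain ⟨a, ha⟩ := hpath v hv
    rw [ha]; exact list_lt_append_singleton _ _
  have hlt' : ∀ v, v ≠ r → (path (p v)).map Neg.neg < (path v).map Neg.neg := fun v hv => by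
    obtain ⟨a, ha⟩ := hpath v hv
    rw [ha, List.map_append]; exact list_lt_append_singleton _ _
  have h1 := ncard_le_three_mul_maxleaf (D := D) (r := r)
    (E := fun u v => D.Adj u v ∧ path u < path v)
    (wellFounded_of_rank path fun u v h => h.2) (fun u v h => h.1)
    (fun v hv => ⟨p v, hp v hv, hlt v hv⟩)
  have h2 := ncard_le_three_mul_maxleaf (D := D) (r := r)
    (E := fun u v => D.Adj u v ∧ (path u).map Neg.neg < (path v).map Neg.neg)
    (wellFounded_of_rank (fun v => (path v).map Neg.neg) fun u v h => h.2) (fun u v h => h.1)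
    (fun v hv => ⟨p v, hp v hv, hlt' v hv⟩)
  refine le_trans (le_trans (Set.ncard_le_ncard ?_ (Set.toFinite _))
    (Set.ncard_union_le _ _)) ((Nat.add_le_add h1 h2).trans (by omega))
  rintro v ⟨u, huv, hn1, hn2⟩
  have hv : v ≠ r := fun h => hn2 (h ▸ ancestor_root hwf u)
  have hup : u ≠ p v := fun h => hn1 (Relation.ReflTransGen.single ⟨hv, h⟩)
  rcases lt_trichotomy (path u) (path v) with h | h | h
  · exact Or.inl ⟨hv, Or.inr ⟨u, p v, hup, ⟨huv, h⟩, hp v hv, hlt v hv⟩⟩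
  · exact absurd (hanc u v (by rw [h])) hn1
  · rcases isPrefix_or_map_neg_lt h with h | h
    · exact absurd (hanc v u h) hn2
    · exact Or.inr ⟨hv, Or.inr ⟨u, p v, hup, ⟨huv, h⟩, hp v hv, hlt' v hv⟩⟩

/-! ### Harmonic functions -/

/-- A function is harmonic at `v` if its value there is the mean of the values at the
in-neighbours of `v`. -/
def IsHarmonicAt {V : Type*} [Finite V] (D : Digraph V) (h : V → ℝ) (v : V) : Prop :=
  ∑ᶠ u ∈ {u | D.Adj u v}, (h v - h u) = 0

theorem IsHarmonicAt.eq_of_le {V : Type*} [Finite V] {D : Digraph V} {h : V → ℝ} {v : V}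
    (hv : IsHarmonicAt D h v) (hle : ∀ u, D.Adj u v → h u ≤ h v) {u : V} (hu : D.Adj u v) :
    h u = h v := by
  classical
  have := Fintype.ofFinite V
  unfold IsHarmonicAt at hv
  rw [finsum_mem_eq_toFinset_sum, Finset.sum_eq_zero_iff_of_nonneg] at hv
  · linarith [hv u (by simpa using hu)]
  · intro w hw
    have := hle w (by simpa using hw)
    linarith

theorem IsHarmonicAt.neg {V : Type*} [Finite V] {D : Digraph V} {h : V → ℝ} {v : V}
    (hv : IsHarmonicAt D h v) : IsHarmonicAt D (fun x => - h x) v := by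
  classical
  have := Fintype.ofFinite V
  unfold IsHarmonicAt at *
  rw [finsum_mem_eq_toFinset_sum] at *
  rw [← neg_eq_zero, ← Finset.sum_neg_distrib, ← hv]
  exact Finset.sum_congr rfl fun x _ => by ring

theorem IsHarmonicAt.strict_or_const {V : Type*} [Finite V] {D : Digraph V} {h : V → ℝ} {v : V}
    (hv : IsHarmonicAt D h v) :
    (∃ u w, D.Adj u v ∧ D.Adj w v ∧ h u < h v ∧ h v < h w) ∨ ∀ u, D.Adj u v → h u = h v := by
  by_cases h1 : ∃ w, D.Adj w v ∧ h v < h w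
  · by_cases h2 : ∃ u, D.Adj u v ∧ h u < h v
    · obtain ⟨w, hw, hw'⟩ := h1
      obtain ⟨u, hu, hu'⟩ := h2
      exact Or.inl ⟨u, w, hu, hw, hu', hw'⟩
    · push Not at h2
      refine Or.inr fun u hu => ?_
      have := hv.neg.eq_of_le (fun u hu => neg_le_neg (h2 u hu)) hu
      linarith
  · push Not at h1
    exact Or.inr fun u hu => hv.eq_of_le h1 hu

/-- There is a directed walk from `r` to `v` that does not enter `x`. -/
def ReachableAvoiding {V : Type*} (D : Digraph V) (r x v : V) : Prop :=
  Relation.ReflTransGen (fun a b => D.Adj a b ∧ b ≠ x) r v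

/-- Maximum principle: a maximum at a harmonic vertex is shared by its in-neighbours, so it travels
backwards along a walk avoiding `x` until it reaches `r`. -/
theorem root_eq_of_isMax {V : Type*} [Finite V] {D : Digraph V} {r x : V} {h : V → ℝ}
    (hh : ∀ v, v ≠ r → v ≠ x → IsHarmonicAt D h v) {v : V} (hv : ReachableAvoiding D r x v)
    (hmax : ∀ u, h u ≤ h v) : h r = h v := by
  induction hv with
  | refl => rfl
  | @tail b c _ hbc ih =>
    by_cases hc : c = r
    · rw [hc]
    · have := (hh c hc hbc.2).eq_of_le (fun u _ => hmax u) hbc.1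
      rw [← this] at hmax ⊢
      exact ih hmax

/-- This is the Dirichlet problem with value 0 at `r` and 1 at `x`. By the maximum principle the
linear operator is injective, hence surjective in finite dimension; a maximum attained off `x` would
equal the value 0 at `r`. -/
theorem exists_harmonic {V : Type*} [Finite V] {D : Digraph V} {r x : V} (hx : r ≠ x)
    (hD : ∀ v, v ≠ x → ReachableAvoiding D r x v) :
    ∃ g : V → ℝ, (∀ v, v ≠ r → v ≠ x → IsHarmonicAt D g v) ∧ ∀ v, v ≠ x → g v < g x := by
  classical
  have := Fintype.ofFinite V
  have hne : Nonempty V := ⟨r⟩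
  let Φ : (V → ℝ) →ₗ[ℝ] (V → ℝ) :=
    { toFun := fun h v => if v = r ∨ v = x then h v else
        ∑ u ∈ {u | D.Adj u v}.toFinset, (h v - h u)
      map_add' := by
        intro f g
        funext v
        simp only [Pi.add_apply]
        split_ifs
        · rfl
        · rw [← Finset.sum_add_distrib]
          exact Finset.sum_congr rfl fun u _ => by ring
      map_smul' := by
        intro c f
        funext v
        simp only [Pi.smul_apply, smul_eq_mul, RingHom.id_apply]
        split_ifs
        · rfl
        · rw [Finset.mul_sum]
          exact Finset.sum_congr rfl fun u _ => by ring }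
  have hΦ : ∀ h v, Φ h v = if v = r ∨ v = x then h v else
        ∑ u ∈ {u | D.Adj u v}.toFinset, (h v - h u) := fun _ _ => rfl
  have hharm : ∀ h v, v ≠ r → v ≠ x → Φ h v = 0 → IsHarmonicAt D h v := by
    intro h v h1 h2 h3
    rw [hΦ, if_neg (by tauto)] at h3
    unfold IsHarmonicAt
    rwa [finsum_mem_eq_toFinset_sum]
  have hle : ∀ h : V → ℝ, (∀ v, v ≠ r → v ≠ x → IsHarmonicAt D h v) → h r = 0 → h x = 0 →
      ∀ v, h v ≤ 0 := by
    intro h hh hr hx' v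
    obtain ⟨m, hm⟩ := Finite.exists_max h
    by_cases hmx : m = x
    · exact (hm v).trans (by rw [hmx, hx'])
    · exact (hm v).trans (by rw [← root_eq_of_isMax hh (hD m hmx) hm, hr])
  have hinj : Function.Injective Φ := by
    rw [injective_iff_map_eq_zero]
    intro h h0
    have hh : ∀ v, v ≠ r → v ≠ x → IsHarmonicAt D h v := fun v h1 h2 =>
      hharm h v h1 h2 (congrFun h0 v)
    have hr : h r = 0 := by
      have := congrFun h0 r
      rwa [hΦ, if_pos (Or.inl rfl)] at this
    have hx' : h x = 0 := by
      have := congrFun h0 x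
      rwa [hΦ, if_pos (Or.inr rfl)] at this
    funext v
    have h1 := hle h hh hr hx' v
    have h2 := hle (fun x => - h x) (fun v h1 h2 => (hh v h1 h2).neg) (by simp [hr])
      (by simp [hx']) v
    simp only [Pi.zero_apply]
    linarith
  obtain ⟨g, hg⟩ := (LinearMap.injective_iff_surjective.1 hinj) (Pi.single x 1)
  have hh : ∀ v, v ≠ r → v ≠ x → IsHarmonicAt D g v := fun v h1 h2 =>
    hharm g v h1 h2 (by rw [hg, Pi.single_eq_of_ne h2])
  have hr : g r = 0 := by
    have := congrFun hg r
    rwa [hΦ, if_pos (Or.inl rfl), Pi.single_eq_of_ne hx] at this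
  have hx' : g x = 1 := by
    have := congrFun hg x
    rwa [hΦ, if_pos (Or.inr rfl), Pi.single_eq_same] at this
  refine ⟨g, hh, fun v hv => ?_⟩
  by_contra hlt
  push Not at hlt
  obtain ⟨m, hm⟩ := Finite.exists_max g
  by_cases hmx : m = x
  · have hm' : ∀ u, g u ≤ g v := fun u => (hm u).trans (hmx ▸ hlt)
    have := root_eq_of_isMax hh (hD v hv) hm'
    linarith
  · have := root_eq_of_isMax hh (hD m hmx) hm
    linarith [hm v]

/-! ### Numberings of digraphs without cut-vertices -/

/-- `f` orders the non-root vertices so that each of them is an out-neighbour of the root or has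
in-neighbours on both sides. -/
structure IsNumbering {V : Type*} (D : Digraph V) (r : V) (f : V → ℝ) : Prop where
  inj : ∀ u v, u ≠ r → v ≠ r → f u = f v → u = v
  between : ∀ v, v ≠ r → ¬ D.Adj r v →
    ∃ u w, D.Adj u v ∧ D.Adj w v ∧ f u < f v ∧ f v < f w

/-- No vertex other than the root is a cut-vertex, and the digraph is connected. -/
structure IsBiconnected {V : Type*} (D : Digraph V) (r : V) : Prop where
  conn : IsConnected D r
  avoid : ∀ x, r ≠ x → ∀ v, v ≠ x → ReachableAvoiding D r x v

theorem exists_entering_edge {V : Type*} {R : V → V → Prop} {r a : V} {L : Set V}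
    (h : Relation.ReflTransGen R r a) (hr : r ∉ L) (ha : a ∈ L) :
    ∃ u v, R u v ∧ u ∉ L ∧ v ∈ L := by
  induction h with
  | refl => exact absurd ha hr
  | @tail b c _ hbc ih =>
    by_cases hb : b ∈ L
    · exact ih hb
    · exact ⟨b, c, hbc, hb, ha⟩

theorem exists_pos_perturbation {V : Type*} [Finite V] (f g : V → ℝ) :
    ∃ ε : ℝ, 0 < ε ∧ ∀ u v, f u < f v → f u + ε * g u < f v + ε * g v := by
  have h : ∀ᶠ ε in nhdsWithin (0 : ℝ) (Set.Ioi 0),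
      ∀ u v, f u < f v → f u + ε * g u < f v + ε * g v := by
    rw [Filter.eventually_all]
    intro u
    rw [Filter.eventually_all]
    intro v
    by_cases huv : f u < f v
    · have hc : ∀ w, Filter.Tendsto (fun ε : ℝ => f w + ε * g w)
          (nhdsWithin (0 : ℝ) (Set.Ioi 0)) (nhds (f w)) := fun w => by
        have : Continuous fun ε : ℝ => f w + ε * g w := by fun_prop
        have h0 := this.tendsto 0
        simp only [zero_mul, add_zero] at h0
        exact h0.mono_left nhdsWithin_le_nhds
      filter_upwards [(hc u).eventually_lt (hc v) huv] with ε hε _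
      exact hε
    · exact Filter.Eventually.of_forall fun ε h => absurd h huv
  obtain ⟨ε, h1, h2⟩ := (h.and self_mem_nhdsWithin).exists
  exact ⟨ε, h2, h1⟩

/-- Start from a constant function and break ties by small harmonic perturbations. The invariant is
that a non-root vertex that is not an out-neighbour of the root has in-neighbours strictly on both
sides or only in-neighbours at its own value; `n` counts the tied pairs. -/
theorem IsBiconnected.exists_numbering {V : Type*} [Finite V] {D : Digraph V} {r : V}
    (hroot : IsRooted D r) (hD : IsBiconnected D r) : ∃ f, IsNumbering D r f := by
  suffices H : ∀ n, ∀ f : V → ℝ,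
      (∀ v, v ≠ r → ¬ D.Adj r v → (∃ u w, D.Adj u v ∧ D.Adj w v ∧ f u < f v ∧ f v < f w) ∨
        ∀ u, D.Adj u v → f u = f v) →
      {q : V × V | q.1 ≠ r ∧ q.2 ≠ r ∧ q.1 ≠ q.2 ∧ f q.1 = f q.2}.ncard = n →
      ∃ f, IsNumbering D r f from
    H _ (fun _ => 0) (fun v _ _ => Or.inr fun _ _ => rfl) rfl
  intro n
  induction n using Nat.strong_induction_on with
  | _ n ih =>
    intro f hf hn
    by_cases hinj : ∀ u v, u ≠ r → v ≠ r → f u = f v → u = v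
    · refine ⟨f, hinj, fun v hv hrv => (hf v hv hrv).resolve_right fun hall => ?_⟩
      rcases Relation.ReflTransGen.cases_tail (hD.conn v) with h | ⟨u, _, huv⟩
      · exact hv h
      · have hur : u ≠ r := fun h => hrv (h ▸ huv)
        have := hinj u v hur hv (hall u huv)
        subst this
        exact hroot.loopless u huv
    · push Not at hinj
      obtain ⟨a, b, ha, hb, hab, hne⟩ := hinj
      -- An edge entering the tied level at `x` comes from the root or from another value, so `x` is
      -- an out-neighbour of the root or already has in-neighbours strictly on both sides. Hence the
      -- perturbation need not be harmonic at `x`, and it lifts `x` above the rest of its level.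
      obtain ⟨u, x, hux, huL, hxL⟩ := exists_entering_edge (L := {v | v ≠ r ∧ f v = f a})
        (hD.conn a) (fun h => h.1 rfl) ⟨ha, rfl⟩
      obtain ⟨c, hcr, hcx, hc⟩ : ∃ c, c ≠ r ∧ c ≠ x ∧ f c = f x := by
        by_cases hax : a = x
        · exact ⟨b, hb, fun h => hne (hax.trans h.symm), hab.symm.trans hxL.2.symm⟩
        · exact ⟨a, ha, hax, hxL.2.symm⟩
      have hx : D.Adj r x ∨ ∃ u w, D.Adj u x ∧ D.Adj w x ∧ f u < f x ∧ f x < f w := by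
        by_cases hrx : D.Adj r x
        · exact Or.inl hrx
        · refine Or.inr ((hf x hxL.1 hrx).resolve_right fun hall => huL ⟨?_, ?_⟩)
          · rintro rfl; exact hrx hux
          · rw [hall u hux, hxL.2]
      obtain ⟨g, hg, hgx⟩ := exists_harmonic hxL.1.symm (hD.avoid x hxL.1.symm)
      obtain ⟨ε, hε, hlt⟩ := exists_pos_perturbation f g
      refine ih _ ?_ (fun v => f v + ε * g v) ?_ rfl
      · rw [← hn]
        apply Set.ncard_lt_ncard _ (Set.toFinite _)
        refine ⟨fun q hq => ⟨hq.1, hq.2.1, hq.2.2.1, ?_⟩, fun h => ?_⟩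
        · by_contra hfq
          rcases lt_or_gt_of_ne hfq with h | h
          · exact (hlt _ _ h).ne hq.2.2.2
          · exact (hlt _ _ h).ne hq.2.2.2.symm
        · have hq := h (a := (c, x)) ⟨hcr, hxL.1, hcx, hc⟩
          have h1 := hq.2.2.2
          have h2 := mul_lt_mul_of_pos_left (hgx c hcx) hε
          simp only at h1
          linarith
      · intro v hv hrv
        have hstrict : (∃ u w, D.Adj u v ∧ D.Adj w v ∧ f u < f v ∧ f v < f w) →
            ∃ u w, D.Adj u v ∧ D.Adj w v ∧ f u + ε * g u < f v + ε * g v ∧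
              f v + ε * g v < f w + ε * g w := by
          rintro ⟨u, w, h1, h2, h3, h4⟩
          exact ⟨u, w, h1, h2, hlt _ _ h3, hlt _ _ h4⟩
        rcases hf v hv hrv with h | hall
        · exact Or.inl (hstrict h)
        · by_cases hvx : v = x
          · subst hvx
            exact Or.inl (hstrict (hx.resolve_left hrv))
          · rcases (hg v hv hvx).strict_or_const with ⟨u, w, h1, h2, h3, h4⟩ | h
            · refine Or.inl ⟨u, w, h1, h2, ?_, ?_⟩
              · have := mul_lt_mul_of_pos_left h3 hε
                rw [hall u h1]; linarith
              · have := mul_lt_mul_of_pos_left h4 hε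
                rw [hall w h2]; linarith
            · exact Or.inr fun u hu => by rw [hall u hu, h u hu]

/-! ### Special vertices in the absence of cut-vertices -/

/-- The edges of `D` that leave the root or go up in the numbering `f`. -/
def ForwardEdge {V : Type*} (D : Digraph V) (r : V) (f : V → ℝ) (u v : V) : Prop :=
  D.Adj u v ∧ (u = r ∨ (u ≠ r ∧ f u < f v))

theorem wellFounded_forwardEdge {V : Type*} [Finite V] {D : Digraph V} {r : V}
    (hroot : IsRooted D r) (f : V → ℝ) : WellFounded (ForwardEdge D r f) := by
  classical
  -- A numbering says nothing about `f r`, so the root is placed below everything.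
  refine wellFounded_of_rank (fun v => if v = r then (⊥ : WithBot ℝ) else (f v : WithBot ℝ)) ?_
  rintro u v ⟨huv, h⟩
  have hv : v ≠ r := fun h => hroot.no_edge_into_root u (h ▸ huv)
  rcases h with h | ⟨h1, h2⟩
  · simp [h, hv]
  · simpa [h1, hv] using h2

theorem IsNumbering.neg {V : Type*} {D : Digraph V} {r : V} {f : V → ℝ}
    (hf : IsNumbering D r f) : IsNumbering D r (fun v => - f v) where
  inj := fun u v hu hv h => hf.inj u v hu hv (neg_injective h)
  between := fun v hv h => by
    obtain ⟨u, w, h1, h2, h3, h4⟩ := hf.between v hv h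
    exact ⟨w, u, h2, h1, neg_lt_neg h4, neg_lt_neg h3⟩

theorem IsNumbering.exists_forwardEdge {V : Type*} {D : Digraph V} {r : V} {f : V → ℝ}
    (hf : IsNumbering D r f) {v : V} (hv : v ≠ r) : ∃ u, ForwardEdge D r f u v := by
  by_cases h : D.Adj r v
  · exact ⟨r, h, Or.inl rfl⟩
  · obtain ⟨u, w, h1, _, h3, _⟩ := hf.between v hv h
    exact ⟨u, h1, Or.inr ⟨fun e => h (e ▸ h1), h3⟩⟩

/-- The out-neighbours of the root and the vertices of in-degree at least `3`. -/
theorem IsNumbering.ncard_inDegree_le {V : Type*} [Finite V] {D : Digraph V} {r : V} {f : V → ℝ}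
    (hroot : IsRooted D r) (hf : IsNumbering D r f) :
    {v | D.Adj r v ∨ 3 ≤ {u | D.Adj u v}.ncard}.ncard ≤ 6 * maxleaf D r := by
  have h1 := ncard_le_three_mul_maxleaf (wellFounded_forwardEdge hroot f) (fun u v h => h.1)
    (fun v hv => hf.exists_forwardEdge hv)
  have h2 := ncard_le_three_mul_maxleaf (wellFounded_forwardEdge hroot fun v => - f v)
    (fun u v h => h.1) (fun v hv => hf.neg.exists_forwardEdge hv)
  refine le_trans (le_trans (Set.ncard_le_ncard ?_ (Set.toFinite _))
    (Set.ncard_union_le _ _)) ((Nat.add_le_add h1 h2).trans (by omega))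
  intro v hv
  by_cases hrv : D.Adj r v
  · exact Or.inl ⟨fun h => hroot.no_edge_into_root r (by rwa [h] at hrv),
      Or.inl ⟨hrv, Or.inl rfl⟩⟩
  · obtain ⟨a, b, c, ha, hb, hc, hab, hac, hbc⟩ :=
      (Set.two_lt_ncard_iff (Set.toFinite _)).1 (hv.resolve_left hrv)
    have hvr : v ≠ r := fun h => hroot.no_edge_into_root a (h ▸ ha)
    have key : ∀ u, D.Adj u v → u ≠ r ∧ (f u < f v ∨ f v < f u) := fun u hu => by
      have hur : u ≠ r := fun h => hrv (h ▸ hu)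
      refine ⟨hur, lt_or_gt_of_ne fun h => ?_⟩
      have := hf.inj u v hur hvr h
      subst this
      exact hroot.loopless u hu
    have up : ∀ u, D.Adj u v → f u < f v → ForwardEdge D r f u v := fun u hu h =>
      ⟨hu, Or.inr ⟨(key u hu).1, h⟩⟩
    have down : ∀ u, D.Adj u v → f v < f u → ForwardEdge D r (fun v => - f v) u v := fun u hu h =>
      ⟨hu, Or.inr ⟨(key u hu).1, neg_lt_neg h⟩⟩
    -- Of three in-neighbours, two lie on the same side of `v`.
    rcases (key a ha).2 with ka | ka <;> rcases (key b hb).2 with kb | kb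
    · exact Or.inl ⟨hvr, Or.inr ⟨a, b, hab, up a ha ka, up b hb kb⟩⟩
    · rcases (key c hc).2 with kc | kc
      · exact Or.inl ⟨hvr, Or.inr ⟨a, c, hac, up a ha ka, up c hc kc⟩⟩
      · exact Or.inr ⟨hvr, Or.inr ⟨b, c, hbc, down b hb kb, down c hc kc⟩⟩
    · rcases (key c hc).2 with kc | kc
      · exact Or.inl ⟨hvr, Or.inr ⟨b, c, hbc, up b hb kb, up c hc kc⟩⟩
      · exact Or.inr ⟨hvr, Or.inr ⟨a, c, hac, down a ha ka, down c hc kc⟩⟩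
    · exact Or.inr ⟨hvr, Or.inr ⟨a, b, hab, down a ha ka, down b hb kb⟩⟩

theorem exists_parent_forwardEdge {V : Type*} {D : Digraph V} {r : V} {f : V → ℝ}
    (hf : IsNumbering D r f) (P : V → V → Prop) :
    ∃ p : V → V, ∀ v, v ≠ r → ForwardEdge D r f (p v) v ∧
      ((∃ u, ForwardEdge D r f u v ∧ P u v) → P (p v) v) := by
  have : ∀ v, ∃ u, v ≠ r → ForwardEdge D r f u v ∧
      ((∃ u, ForwardEdge D r f u v ∧ P u v) → P u v) := fun v => by
    by_cases hv : v = r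
    · exact ⟨v, fun h => absurd hv h⟩
    · by_cases h : ∃ u, ForwardEdge D r f u v ∧ P u v
      · obtain ⟨u, hu⟩ := h
        exact ⟨u, fun _ => ⟨hu.1, fun _ => hu.2⟩⟩
      · obtain ⟨u, hu⟩ := hf.exists_forwardEdge hv
        exact ⟨u, fun _ => ⟨hu, fun h' => absurd h' h⟩⟩
  choose p hp using this
  exact ⟨p, hp⟩

theorem wellFounded_parentRel {V : Type*} {E : V → V → Prop} (hwf : WellFounded E) {r : V}
    {p : V → V} (hp : ∀ v, v ≠ r → E (p v) v) : WellFounded (ParentRel r p) :=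
  Subrelation.wf (fun {u v} h => by obtain ⟨hv, rfl⟩ := h; exact hp v hv) hwf

theorem Ancestor.le_of_forwardEdge {V : Type*} {D : Digraph V} {r : V} {f : V → ℝ}
    {p : V → V} (hp : ∀ v, v ≠ r → ForwardEdge D r f (p v) v) {u v : V}
    (h : Ancestor r p u v) (hu : u ≠ r) : v ≠ r ∧ f u ≤ f v := by
  induction h with
  | refl => exact ⟨hu, le_rfl⟩
  | @tail b c _ hbc ih =>
    obtain ⟨hc, rfl⟩ := hbc
    rcases (hp c hc).2 with h | h
    · exact absurd h ih.1
    · exact ⟨hc, ih.2.trans h.2.le⟩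

/-- The heads of simple edges that go down in the numbering. -/
theorem IsNumbering.ncard_simpleDown_le {V : Type*} [Finite V] {D : Digraph V} {r : V} {f : V → ℝ}
    (hroot : IsRooted D r) (hf : IsNumbering D r f) :
    {v | v ≠ r ∧ ¬ D.Adj r v ∧ ∃ u, D.Adj u v ∧ ¬ D.Adj v u ∧ f v < f u}.ncard
      ≤ 12 * maxleaf D r := by
  classical
  obtain ⟨p, hp⟩ := exists_parent_forwardEdge hf fun _ _ => True
  -- The downward tree prefers simple edges, so for `v` in `S` the edge from `q v` to `v` is simple.
  obtain ⟨q, hq⟩ := exists_parent_forwardEdge hf.neg fun u v => ¬ D.Adj v u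
  have hp1 := fun v hv => (hp v hv).1
  have hq1 := fun v hv => (hq v hv).1
  have h1 := ncard_transverseHeads_le (D := D)
    (wellFounded_parentRel (wellFounded_forwardEdge hroot f) hp1) fun v hv => (hp1 v hv).1
  have h2 := ncard_transverseHeads_le (D := D)
    (wellFounded_parentRel (wellFounded_forwardEdge hroot fun v => - f v) hq1)
    fun v hv => (hq1 v hv).1
  set S := {v | v ≠ r ∧ ¬ D.Adj r v ∧ ∃ u, D.Adj u v ∧ ¬ D.Adj v u ∧ f v < f u} with hS
  have key : ∀ v, v ∈ S → v ∉ transverseHeads D r p →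
      ∃ c, c ≠ r ∧ p c = v ∧ c ∈ transverseHeads D r q := by
    rintro v ⟨hvr, hrv, u₀, hu₀, hvu₀, hlt₀⟩ hnt
    have hu₀r : u₀ ≠ r := fun h => hrv (h ▸ hu₀)
    have hvq : ¬ D.Adj v (q v) := (hq v hvr).2 ⟨u₀, ⟨hu₀, Or.inr ⟨hu₀r, neg_lt_neg hlt₀⟩⟩, hvu₀⟩
    have hqv : D.Adj (q v) v := (hq1 v hvr).1
    have hqr : q v ≠ r := fun h => hrv (h ▸ hqv)
    have hlt : f v < f (q v) := by
      rcases (hq1 v hvr).2 with h | h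
      · exact absurd h hqr
      · exact neg_lt_neg_iff.1 h.2
    -- If `v` is not a transverse head for `p`, it lies below `q v` in the numbering and is an
    -- ancestor of `q v` in the upward tree. Let `c` be the child of `v` towards `q v`. It differs
    -- from `q v` because `(v, q v)` is not an edge, so `f v < f c < f (q v)`. This makes the edge
    -- from `v` to `c` transverse to the downward tree, and `v` is recovered as `p c`.
    have hanc : Ancestor r p v (q v) := by
      by_contra h
      refine hnt ⟨q v, hqv, fun h' => ?_, h⟩
      have := (h'.le_of_forwardEdge hp1 hqr).2
      linarith
    rcases Relation.ReflTransGen.cases_head hanc with h | ⟨c, ⟨hc, hvc⟩, hcq⟩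
    · rw [← h] at hlt
      exact absurd hlt (lt_irrefl _)
    · have hadj : D.Adj v c := hvc ▸ (hp1 c hc).1
      have hvc' : f v < f c := by
        have h3 := hp1 c hc
        rw [← hvc] at h3
        rcases h3.2 with h | h
        · exact absurd h hvr
        · exact h.2
      have hcne : c ≠ q v := fun h => hvq (h ▸ hadj)
      have hclt : f c < f (q v) := lt_of_le_of_ne
        (Ancestor.le_of_forwardEdge hp1 hcq hc).2 fun h => hcne (hf.inj _ _ hc hqr h)
      refine ⟨c, hc, hvc.symm, v, hadj, fun h => ?_, fun h => ?_⟩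
      · have := (h.le_of_forwardEdge hq1 hvr).2
        linarith
      · rcases Relation.ReflTransGen.cases_tail h with h | ⟨b, hcb, _, hb⟩
        · rw [h] at hvc'; exact lt_irrefl _ hvc'
        · rw [hb] at hcb
          have := (Ancestor.le_of_forwardEdge hq1 hcb hc).2
          linarith
  have hsub : S ⊆ transverseHeads D r p ∪ p '' transverseHeads D r q := fun v hv => by
    by_cases h : v ∈ transverseHeads D r p
    · exact Or.inl h
    · obtain ⟨c, _, hc, hc'⟩ := key v hv h
      exact Or.inr ⟨c, hc', hc⟩
  have h3 := Set.ncard_image_le (f := p) (Set.toFinite (transverseHeads D r q))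
  exact (Set.ncard_le_ncard hsub (Set.toFinite _)).trans
    ((Set.ncard_union_le _ _).trans (by omega))

theorem IsBiconnected.ncard_sp_le {V : Type*} [Finite V] {D : Digraph V} {r : V}
    (hroot : IsRooted D r) (hD : IsBiconnected D r) : (sp D).ncard ≤ 30 * maxleaf D r := by
  obtain ⟨f, hf⟩ := hD.exists_numbering hroot
  have h1 := hf.ncard_inDegree_le hroot
  have h2 := hf.ncard_simpleDown_le hroot
  have h3 := hf.neg.ncard_simpleDown_le hroot
  refine le_trans (le_trans (Set.ncard_le_ncard ?_ (Set.toFinite _))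
    ((Set.ncard_union_le _ _).trans (Nat.add_le_add_left (Set.ncard_union_le _ _) _)))
    ((Nat.add_le_add h1 (Nat.add_le_add h2 h3)).trans (by omega))
  intro v hv
  by_cases hrv : D.Adj r v
  · exact Or.inl (Or.inl hrv)
  · rcases hv with hv | ⟨u, huv, hvu⟩
    · exact Or.inl (Or.inr hv)
    · have hvr : v ≠ r := fun h => hroot.no_edge_into_root u (h ▸ huv)
      have hur : u ≠ r := fun h => hrv (h ▸ huv)
      rcases lt_trichotomy (f v) (f u) with h | h | h
      · exact Or.inr (Or.inl ⟨hvr, hrv, u, huv, hvu, h⟩)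
      · have := hf.inj v u hvr hur h
        subst this
        exact absurd huv (hroot.loopless v)
      · exact Or.inr (Or.inr ⟨hvr, hrv, u, huv, hvu, neg_lt_neg h⟩)

/-! ### Breadth-first levels -/

/-- Breadth-first levels of a relation in which everything is reachable from `r`. -/
theorem exists_levels {V : Type*} {E : V → V → Prop} {r : V}
    (h : ∀ v, Relation.ReflTransGen E r v) :
    ∃ d : V → ℕ, (∀ v, v ≠ r → ∃ u, E u v ∧ d v = d u + 1) ∧ ∀ u v, E u v → d v ≤ d u + 1 := by
  classical
  let R : ℕ → V → Prop := fun n => Nat.rec (motive := fun _ => V → Prop) (fun v => v = r) (fun _ ih v => ∃ u, ih u ∧ E u v) n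
  have hR : ∀ v, ∃ n, R n v := fun v => by
    induction h v with
    | refl => exact ⟨0, rfl⟩
    | tail _ hbc ih =>
      obtain ⟨n, hn⟩ := ih
      exact ⟨n + 1, _, hn, hbc⟩
  have hstep : ∀ u v, E u v → Nat.find (hR v) ≤ Nat.find (hR u) + 1 := fun u v huv =>
    Nat.find_min' (hR v) ⟨u, Nat.find_spec (hR u), huv⟩
  refine ⟨fun v => Nat.find (hR v), fun v hv => ?_, hstep⟩
  have hs := Nat.find_spec (hR v)
  cases hn : Nat.find (hR v) with
  | zero =>
    rw [hn] at hs
    exact absurd hs hv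
  | succ n =>
    rw [hn] at hs
    obtain ⟨u, hu, huv⟩ := hs
    refine ⟨u, huv, ?_⟩
    have h1 := hstep u v huv
    have h2 := Nat.find_min' (hR u) hu
    simp only
    omega

/-- If everything is reachable using only edges with tails in `I`, then the vertices outside `I`
can be made leaves. -/
theorem ncard_compl_le_maxleaf {V : Type*} [Finite V] {D : Digraph V} {r : V} {I : Set V}
    (h : ∀ v, Relation.ReflTransGen (fun a b => D.Adj a b ∧ a ∈ I) r v) :
    Iᶜ.ncard ≤ maxleaf D r := by
  obtain ⟨d, hd, _⟩ := exists_levels h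
  have : ∀ v, ∃ u, v ≠ r → (D.Adj u v ∧ u ∈ I) ∧ d v = d u + 1 := fun v => by
    by_cases hv : v = r
    · exact ⟨v, fun h => absurd hv h⟩
    · exact (hd v hv).imp fun u hu _ => hu
  choose p hp using this
  exact ncard_le_maxleaf_of_parent (E := fun u v => D.Adj u v ∧ d u < d v)
    (wellFounded_of_rank d fun u v h => h.2) (fun u v h => h.1) p
    (fun v hv => ⟨(hp v hv).1.1, by have := (hp v hv).2; omega⟩)
    fun v hv h => h (hp v hv).1.2

/-! ### Duplicating the cut-vertices -/

/-- The projection that identifies the second copies of the cut-vertices with the first ones. -/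
def copyProj {V : Type*} (D : Digraph V) (r : V) : V ⊕ cv D r → V := Sum.elim id Subtype.val

/-- The digraph in which every cut-vertex is duplicated. -/
def duplicateCutVertices {V : Type*} (D : Digraph V) (r : V) : Digraph (V ⊕ cv D r) where
  Adj a b := D.Adj (copyProj D r a) (copyProj D r b)

theorem isRooted_duplicate {V : Type*} {D : Digraph V} {r : V} (hroot : IsRooted D r) :
    IsRooted (duplicateCutVertices D r) (Sum.inl r) where
  loopless := fun _ => hroot.loopless _
  no_edge_into_root := fun _ => hroot.no_edge_into_root _

theorem reflTransGen_map {V W : Type*} {R : V → V → Prop} {S : W → W → Prop} (s : V → W)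
    (hs : ∀ a b, R a b → S (s a) (s b)) {a b : V} (h : Relation.ReflTransGen R a b) :
    Relation.ReflTransGen S (s a) (s b) := by
  induction h with
  | refl => exact Relation.ReflTransGen.refl
  | tail _ hbc ih => exact ih.tail (hs _ _ hbc)

theorem isCutVertex_iff {V : Type*} {D : Digraph V} {r x : V} (hx : r ≠ x) :
    IsCutVertex D r x ↔ ¬ ∀ v, v ≠ x → ReachableAvoiding D r x v := by
  have key : IsConnected (deleteVertex D x) ⟨r, hx⟩ ↔ ∀ v, v ≠ x → ReachableAvoiding D r x v := by
    constructor
    · intro h v hv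
      exact reflTransGen_map (S := fun a b => D.Adj a b ∧ b ≠ x) Subtype.val
        (fun a b hab => ⟨hab, b.2⟩) (h ⟨v, hv⟩)
    · rintro h ⟨v, hv⟩
      have := h v hv
      unfold ReachableAvoiding at this
      induction this with
      | refl => exact Relation.ReflTransGen.refl
      | @tail b c hb hbc ih =>
        have hbx : b ≠ x := by
          rcases Relation.ReflTransGen.cases_tail hb with h | ⟨_, _, h⟩
          · rwa [h]
          · exact h.2
        exact (ih hbx).tail (show D.Adj b c from hbc.1)
  unfold IsCutVertex
  rw [← key]
  exact ⟨fun ⟨_, h⟩ => h, fun h => ⟨hx, h⟩⟩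

theorem root_notMem_cv {V : Type*} (D : Digraph V) (r : V) : r ∉ cv D r := fun h => h.1 rfl

theorem eq_inl_root {V : Type*} {D : Digraph V} {r : V} {b : V ⊕ cv D r}
    (h : copyProj D r b = r) : b = Sum.inl r := by
  rcases b with b | ⟨b, hb⟩
  · exact congrArg Sum.inl h
  · have : b = r := h
    exact absurd (this ▸ hb) (root_notMem_cv D r)

/-- If a copy of a cut-vertex is deleted, walks can be rerouted through its twin. Any other deleted
vertex comes from a vertex that is not a cut-vertex of `D`, so avoiding walks lift. -/
theorem isBiconnected_duplicate {V : Type*} {D : Digraph V} {r : V} (hconn : IsConnected D r) :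
    IsBiconnected (duplicateCutVertices D r) (Sum.inl r) := by
  classical
  have conn : IsConnected (duplicateCutVertices D r) (Sum.inl r) := fun b => by
    rcases Relation.ReflTransGen.cases_tail (hconn (copyProj D r b)) with h | ⟨c, hc, hcb⟩
    · rw [eq_inl_root h]; exact Relation.ReflTransGen.refl
    · exact (reflTransGen_map (S := (duplicateCutVertices D r).Adj) Sum.inl
        (fun _ _ h => h) hc).tail hcb
  refine ⟨conn, fun x hx b hb => ?_⟩
  by_cases hcut : copyProj D r x ∈ cv D r
  · obtain ⟨y, hyx, hy⟩ : ∃ y, y ≠ x ∧ copyProj D r y = copyProj D r x := by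
      rcases x with x | ⟨x, hx'⟩
      · exact ⟨Sum.inr ⟨x, hcut⟩, by simp, rfl⟩
      · exact ⟨Sum.inl x, by simp, rfl⟩
    have hxr : r ≠ copyProj D r x := fun h => root_notMem_cv D r (by rwa [← h] at hcut)
    let s : V → V ⊕ cv D r := fun v => if v = copyProj D r x then y else Sum.inl v
    have hsr : s r = Sum.inl r := if_neg hxr
    have hsπ : ∀ a, copyProj D r (s a) = a := fun a => by
      by_cases h : a = copyProj D r x
      · rw [show s a = y from if_pos h, hy, h]
      · rw [show s a = Sum.inl a from if_neg h]; rfl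
    have hsx : ∀ a, s a ≠ x := fun a h => by
      by_cases h' : a = copyProj D r x
      · rw [show s a = y from if_pos h'] at h
        exact hyx h
      · apply h'
        rw [← h, hsπ]
    have hlift : ∀ v, ReachableAvoiding (duplicateCutVertices D r) (s r) x (s v) := fun v =>
      reflTransGen_map s (fun a b hab =>
        ⟨show D.Adj (copyProj D r (s a)) (copyProj D r (s b)) by rwa [hsπ, hsπ], hsx b⟩)
        (hconn v)
    rw [hsr] at hlift
    rcases Relation.ReflTransGen.cases_tail (hconn (copyProj D r b)) with h | ⟨c, _, hcb⟩
    · rw [eq_inl_root h]; exact Relation.ReflTransGen.refl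
    · exact (hlift c).tail
        ⟨show D.Adj (copyProj D r (s c)) (copyProj D r b) by rwa [hsπ], hb⟩
  · have hxr : r ≠ copyProj D r x := fun h => hx (eq_inl_root h.symm).symm
    have hav := not_not.1 fun h => hcut ((isCutVertex_iff hxr).2 h)
    have hbx : copyProj D r b ≠ copyProj D r x := by
      intro h
      rcases b with b | ⟨b, hb'⟩ <;> rcases x with x | ⟨x, hx'⟩
      · exact hb (congrArg Sum.inl h)
      · exact hcut hx'
      · exact hcut (h ▸ hb')
      · exact hcut hx'
    have hlift : ∀ {v}, ReachableAvoiding D r (copyProj D r x) v →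
        ReachableAvoiding (duplicateCutVertices D r) (Sum.inl r) x (Sum.inl v) := fun h =>
      reflTransGen_map Sum.inl (fun a b hab =>
        ⟨hab.1, fun h => hab.2 (by rw [← h]; rfl)⟩) h
    rcases Relation.ReflTransGen.cases_tail (hav _ hbx) with h | ⟨c, hc, hcb⟩
    · rw [eq_inl_root h]; exact Relation.ReflTransGen.refl
    · exact (hlift hc).tail ⟨hcb.1, hb⟩

theorem exists_outbranching {V : Type*} [Finite V] {D : Digraph V} {r : V}
    (hconn : IsConnected D r) :
    ∃ T, IsOutbranching D r T ∧ (leaves T).ncard = maxleaf D r := by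
  obtain ⟨d, hd, _⟩ := exists_levels hconn
  have : ∀ v, ∃ u, v ≠ r → D.Adj u v ∧ d v = d u + 1 := fun v => by
    by_cases hv : v = r
    · exact ⟨v, fun h => absurd hv h⟩
    · exact (hd v hv).imp fun u hu _ => hu
  choose p hp using this
  have hT := isOutbranching_of_parent (D := D) (r := r) (E := fun u v => D.Adj u v ∧ d u < d v)
    (wellFounded_of_rank d fun u v h => h.2) (fun u v h => h.1) p
    (fun v hv => ⟨(hp v hv).1, by have := (hp v hv).2; omega⟩)
  exact Nat.sSup_mem (s := {k | ∃ T, IsOutbranching D r T ∧ (leaves T).ncard = k})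
    ⟨_, _, hT, rfl⟩ (bddAbove_leafCounts D r)

/-- Projecting an optimal outbranching `T` shows that the projections `I` of its internal vertices
suffice as tails, so the vertices outside `I` can be leaves in `D`. A leaf of `T` that projects into
`I` has an internal twin, and is charged to that cut-vertex. -/
theorem maxleaf_duplicate_le {V : Type*} [Finite V] {D : Digraph V} {r : V}
    (hconn : IsConnected D r) :
    maxleaf (duplicateCutVertices D r) (Sum.inl r) ≤ maxleaf D r + (cv D r).ncard := by
  classical
  obtain ⟨T, hT, hleaf⟩ := exists_outbranching (isBiconnected_duplicate hconn).conn
  rw [← hleaf]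
  have hI := ncard_compl_le_maxleaf (D := D) (r := r) (I := copyProj D r '' (leaves T)ᶜ)
    fun v => reflTransGen_map (S := fun a b => D.Adj a b ∧ _) (copyProj D r)
      (fun a b hab => ⟨hT.le hab, a, fun h => h b hab, rfl⟩) (hT.reachable (Sum.inl v))
  set I := copyProj D r '' (leaves T)ᶜ with hIdef
  have hcv : ∀ v, Sum.inl v ∈ leaves T → v ∈ I → ∃ h : v ∈ cv D r, Sum.inr ⟨v, h⟩ ∉ leaves T := by
    rintro v hv ⟨a | ⟨a, ha⟩, hal, hav⟩
    · have : a = v := hav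
      exact absurd (this ▸ hv) hal
    · have : a = v := hav
      subst this
      exact ⟨ha, hal⟩
  clear_value I
  have hinj : (leaves T).ncard ≤ (Sum.inl '' Iᶜ ∪ Set.range Sum.inr : Set (V ⊕ cv D r)).ncard := by
    -- A leaf whose twin is internal is sent to the second copy. There is no collision, since that
    -- copy is not a leaf.
    refine Set.ncard_le_ncard_of_injOn (fun a => match a with
      | Sum.inl v => if h : v ∈ I ∧ v ∈ cv D r then Sum.inr ⟨v, h.2⟩ else Sum.inl v
      | Sum.inr w => Sum.inr w) ?_ ?_ (Set.toFinite _)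
    · rintro (v | w) ha
      · by_cases h : v ∈ I
        · simp [h, (hcv v ha h).1]
        · simp [h]
      · simp
    · rintro (v | w) ha (v' | w') ha' h
      · by_cases h1 : v ∈ I ∧ v ∈ cv D r <;> by_cases h2 : v' ∈ I ∧ v' ∈ cv D r <;>
          simp [h1, h2] at h <;> simp [h]
      · by_cases h1 : v ∈ I ∧ v ∈ cv D r
        · simp only [h1, and_self, dite_true, Sum.inr.injEq] at h
          subst h
          exact absurd ha' (hcv v ha h1.1).2
        · simp [h1] at h
      · by_cases h1 : v' ∈ I ∧ v' ∈ cv D r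
        · simp only [h1, and_self, dite_true, Sum.inr.injEq] at h
          subst h
          exact absurd ha (hcv v' ha' h1.1).2
        · simp [h1] at h
      · exact h
  have h1 := Set.ncard_union_le (Sum.inl '' Iᶜ : Set (V ⊕ cv D r)) (Set.range Sum.inr)
  have h2 := Set.ncard_image_le (f := (Sum.inl : V → V ⊕ cv D r)) (Set.toFinite Iᶜ)
  have h3 : (Set.range (Sum.inr : cv D r → V ⊕ cv D r)).ncard = (cv D r).ncard := by
    rw [← Set.image_univ, Set.ncard_image_of_injective _ Sum.inr_injective, Set.ncard_univ]
    rfl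
  omega

theorem ncard_sp_le_duplicate {V : Type*} [Finite V] (D : Digraph V) (r : V) :
    (sp D).ncard ≤ (sp (duplicateCutVertices D r)).ncard := by
  refine Set.ncard_le_ncard_of_injOn Sum.inl ?_ Sum.inl_injective.injOn (Set.toFinite _)
  rintro v (hv | ⟨u, huv, hvu⟩)
  · refine Or.inl (hv.trans ?_)
    exact Set.ncard_le_ncard_of_injOn Sum.inl (fun u hu => hu) Sum.inl_injective.injOn
      (Set.toFinite _)
  · exact Or.inr ⟨Sum.inl u, huv, hvu⟩

/-! ### Bounding the number of cut-vertices -/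

/-- In a connected digraph whose cut-edges are all branching, a cut-vertex has two out-neighbours
that cannot be reached without it. -/
theorem exists_two_dominated {V : Type*} {D : Digraph V} {r v : V} (hconn : IsConnected D r)
    (hbranch : ∀ u v, IsCutEdge D r u v → IsBranching D r u v) (hv : v ∈ cv D r) :
    ∃ a b, a ≠ b ∧ (D.Adj v a ∧ a ≠ v ∧ ¬ ReachableAvoiding D r v a) ∧
      (D.Adj v b ∧ b ≠ v ∧ ¬ ReachableAvoiding D r v b) := by
  have hrv : r ≠ v := hv.1
  have hU := (isCutVertex_iff hrv).1 hv
  push Not at hU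
  obtain ⟨z, hzv, hz⟩ := hU
  -- The set of vertices unreachable without `v` can be entered only from `v`. Were there a single
  -- such edge `(v, a)`, it would be a cut-edge, with a second cut-edge `(v, w)`. But `w` would be
  -- reachable without `v` or equal to `v`, so deleting `(v, w)` could not disconnect anything.
  have henter : ∀ a b, D.Adj a b → ¬ (a ≠ v ∧ ¬ ReachableAvoiding D r v a) →
      (b ≠ v ∧ ¬ ReachableAvoiding D r v b) → a = v := by
    intro a b hab ha hb
    by_contra hav
    exact hb.2 ((not_not.1 fun h => ha ⟨hav, h⟩).tail ⟨hab, hb.1⟩)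
  have hr : ¬ (r ≠ v ∧ ¬ ReachableAvoiding D r v r) := fun h => h.2 Relation.ReflTransGen.refl
  obtain ⟨a', a, ha'a, ha', ha⟩ := exists_entering_edge
    (L := {a | a ≠ v ∧ ¬ ReachableAvoiding D r v a}) (hconn z) hr ⟨hzv, hz⟩
  have hva : D.Adj v a := henter a' a ha'a ha' ha ▸ ha'a
  by_contra hcon
  have huniq : ∀ b, D.Adj v b → b ≠ v → ¬ ReachableAvoiding D r v b → b = a := by
    intro b h1 h2 h3
    by_contra hne
    exact hcon ⟨a, b, fun h => hne h.symm, ⟨hva, ha⟩, ⟨h1, h2, h3⟩⟩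
  have hcut : IsCutEdge D r v a := by
    refine ⟨hva, fun h => ?_⟩
    obtain ⟨c', c, hc, hc1, hc2⟩ := exists_entering_edge
      (L := {a | a ≠ v ∧ ¬ ReachableAvoiding D r v a}) (h z) hr ⟨hzv, hz⟩
    have := henter c' c hc.1 hc1 hc2
    subst this
    exact hc.2 ⟨rfl, huniq c hc.1 hc2.1 hc2.2⟩
  obtain ⟨_, w, hwa, hvw, hw⟩ := hbranch v a hcut
  apply hw
  have hreach : ∀ {x}, ReachableAvoiding D r v x → x ≠ v → Reachable (deleteEdge D v w) r x := by
    intro x hx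
    induction hx with
    | refl => exact fun _ => Relation.ReflTransGen.refl
    | @tail b c hb hbc ih =>
      intro hc
      have hbv : b ≠ v := by
        rcases Relation.ReflTransGen.cases_tail hb with h | ⟨_, _, h⟩
        · rwa [h]
        · exact h.2
      exact (ih hbv).tail ⟨hbc.1, fun h => hbv h.1⟩
  have hwv : w ≠ v ∧ ReachableAvoiding D r v w ∨ w = v := by
    by_cases h : w = v
    · exact Or.inr h
    · refine Or.inl ⟨h, ?_⟩
      by_contra h'
      exact hwa (huniq w hvw h h')
  intro x
  by_contra hx
  obtain ⟨b, c, hbc, hb, hc⟩ := exists_entering_edge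
    (L := {a | ¬ Reachable (deleteEdge D v w) r a}) (hconn x)
    (fun h => h Relation.ReflTransGen.refl) hx
  have hb := not_not.1 hb
  have hbw : b = v ∧ c = w := by
    by_contra h
    exact hc (hb.tail ⟨hbc, h⟩)
  obtain ⟨rfl, rfl⟩ := hbw
  rcases hwv with h | h
  · exact hc (hreach h.2 h.1)
  · subst h
    exact hc hb

/-- Count tree edges by their tails: each internal vertex contributes at least one and each vertex
of `C` at least two, so the number of internal vertices plus `|C|` is at most `n`. -/
theorem ncard_le_maxleaf_of_two_children {V : Type*} [Finite V] {D : Digraph V} {r : V}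
    {E : V → V → Prop} (hwf : WellFounded E) (hED : ∀ u v, E u v → D.Adj u v) (p : V → V)
    (hp : ∀ v, v ≠ r → E (p v) v) {C : Set V}
    (hC : ∀ v ∈ C, ∃ a b, a ≠ b ∧ (a ≠ r ∧ p a = v) ∧ (b ≠ r ∧ p b = v)) :
    C.ncard ≤ maxleaf D r := by
  classical
  have := Fintype.ofFinite V
  set I : Finset V := (Finset.univ.erase r).image p with hI
  have hleaf := ncard_le_maxleaf_of_parent (D := D) (r := r) hwf hED p hp
    (S := ((Finset.univ \ I : Finset V) : Set V)) fun v hv h => by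
      simp only [Finset.coe_sdiff, Set.mem_sdiff, Finset.mem_coe] at h
      exact h.2 (Finset.mem_image_of_mem _ (by simp [hv]))
  rw [Set.ncard_coe_finset] at hleaf
  have hCt : C.ncard = C.toFinset.card := Set.ncard_eq_toFinset_card' C
  have h1 : (Finset.univ.erase r).card =
      ∑ b ∈ I, ((Finset.univ.erase r).filter fun a => p a = b).card :=
    Finset.card_eq_sum_card_fiberwise fun a ha => Finset.mem_image_of_mem _ ha
  have hCI : C.toFinset ⊆ I := fun v hv => by
    obtain ⟨a, _, _, ⟨har, rfl⟩, _⟩ := hC v (Set.mem_toFinset.1 hv)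
    exact Finset.mem_image_of_mem _ (by simp [har])
  have h2 : ∑ b ∈ I, (1 + if b ∈ C.toFinset then 1 else 0) ≤
      ∑ b ∈ I, ((Finset.univ.erase r).filter fun a => p a = b).card := by
    refine Finset.sum_le_sum fun b hb => ?_
    by_cases hbC : b ∈ C.toFinset
    · rw [if_pos hbC]
      obtain ⟨x, y, hxy, hx, hy⟩ := hC b (Set.mem_toFinset.1 hbC)
      exact Finset.one_lt_card.2 ⟨x, by simp [hx], y, by simp [hy], hxy⟩
    · rw [if_neg hbC]
      obtain ⟨x, hx, hxb⟩ := Finset.mem_image.1 hb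
      exact Finset.card_pos.2 ⟨x, Finset.mem_filter.2 ⟨hx, hxb⟩⟩
  rw [Finset.sum_add_distrib, Finset.sum_const, smul_eq_mul, mul_one, Finset.sum_ite_mem,
    Finset.inter_eq_right.2 hCI, Finset.sum_const, smul_eq_mul, mul_one] at h2
  have h3 : (Finset.univ \ I).card + I.card = (Finset.univ : Finset V).card :=
    Finset.card_sdiff_add_card_eq_card (Finset.subset_univ _)
  have h4 := Finset.card_erase_le (s := (Finset.univ : Finset V)) (a := r)
  omega

theorem ncard_cv_le_maxleaf {V : Type*} [Finite V] {D : Digraph V} {r : V}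
    (hconn : IsConnected D r) (hbranch : ∀ u v, IsCutEdge D r u v → IsBranching D r u v) :
    (cv D r).ncard ≤ maxleaf D r := by
  obtain ⟨d, hd, hd'⟩ := exists_levels hconn
  have : ∀ v, ∃ u, v ≠ r → D.Adj u v ∧ d v = d u + 1 := fun v => by
    by_cases hv : v = r
    · exact ⟨v, fun h => absurd hv h⟩
    · exact (hd v hv).imp fun u hu _ => hu
  choose p hp using this
  refine ncard_le_maxleaf_of_two_children (E := fun u v => D.Adj u v ∧ d u < d v)
    (wellFounded_of_rank d fun u v h => h.2) (fun u v h => h.1) p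
    (fun v hv => ⟨(hp v hv).1, by have := (hp v hv).2; omega⟩) fun v hv => ?_
  have hpar : ∀ x, x ≠ v → ¬ ReachableAvoiding D r v x →
      x ≠ r ∧ (p x ≠ v → ¬ ReachableAvoiding D r v (p x)) := fun x hxv hx => by
    have hxr : x ≠ r := fun h => hx (h ▸ Relation.ReflTransGen.refl)
    exact ⟨hxr, fun _ h => hx (h.tail ⟨(hp x hxr).1, hxv⟩)⟩
  -- Following parents from a vertex unreachable without `v` must lead to `v`, so it lies strictly
  -- deeper. If such an out-neighbour `a` of `v` had another parent, that parent would be deeper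
  -- than `v` too, giving `d a ≥ d v + 2`, which the edge `(v, a)` forbids.
  have hlt : ∀ n, ∀ x, d x = n → x ≠ v → ¬ ReachableAvoiding D r v x → d v < d x := by
    intro n
    induction n with
    | zero =>
      intro x hn hxv hx
      have := (hp x (hpar x hxv hx).1).2
      omega
    | succ n ih =>
      intro x hn hxv hx
      obtain ⟨hxr, h⟩ := hpar x hxv hx
      have h1 := (hp x hxr).2
      by_cases hpv : p x = v
      · rw [hpv] at h1; omega
      · have := ih (p x) (by omega) hpv (h hpv)
        omega
  have hchild : ∀ a, D.Adj v a ∧ a ≠ v ∧ ¬ ReachableAvoiding D r v a → a ≠ r ∧ p a = v := by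
    rintro a ⟨hva, hav, ha⟩
    obtain ⟨har, h⟩ := hpar a hav ha
    refine ⟨har, ?_⟩
    by_contra hpv
    have h1 := hlt _ (p a) rfl hpv (h hpv)
    have h2 := hd' v a hva
    have h3 := (hp a har).2
    omega
  obtain ⟨a, b, hab, ha, hb⟩ := exists_two_dominated hconn hbranch hv
  exact ⟨a, b, hab, hchild a ha, hchild b hb⟩

end RootedDigraph

theorem mainTheorem5 {V : Type*} [Finite V] (D : Digraph V) (r : V)
    (hroot : RootedDigraph.IsRooted D r)
    (hconn : RootedDigraph.IsConnected D r)
    (hbranch : ∀ u v, RootedDigraph.IsCutEdge D r u v → RootedDigraph.IsBranching D r u v) :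
    ((RootedDigraph.sp D).ncard : ℝ) / 30 - ((RootedDigraph.cv D r).ncard : ℝ)
        ≤ (RootedDigraph.maxleaf D r : ℝ) ∧
      ((RootedDigraph.sp D).ncard : ℝ) / 60 ≤ (RootedDigraph.maxleaf D r : ℝ) := by
  have h1 := RootedDigraph.ncard_sp_le_duplicate D r
  have h2 := (RootedDigraph.isBiconnected_duplicate hconn).ncard_sp_le
    (RootedDigraph.isRooted_duplicate hroot)
  have h3 := RootedDigraph.maxleaf_duplicate_le hconn
  have h4 := RootedDigraph.ncard_cv_le_maxleaf hconn hbranch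
  have h5 : ((RootedDigraph.sp D).ncard : ℝ) ≤
      30 * (RootedDigraph.maxleaf D r + (RootedDigraph.cv D r).ncard) := by
    exact_mod_cast (h1.trans h2).trans (Nat.mul_le_mul_left 30 h3)
  have h6 : ((RootedDigraph.cv D r).ncard : ℝ) ≤ RootedDigraph.maxleaf D r := by
    exact_mod_cast h4
  constructor <;> linarith
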